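/- For a finite connected graph $\Gamma$, the metric dimension $\mu(\Gamma)$ is the least size of a set $R$ of vertices such that any two distinct vertices $u,w$ satisfy $\mathrm{d}(u,r)\neq \mathrm{d}(w,r)$ for some $r\in R$. A strongly regular graph with parameters $(n,k,a,c)$ is a connected $k$-regular graph of diameter $2$ on $n$ vertices in which any two adjacent vertices have exactly $a$ common neighbours and any two distinct non-adjacent vertices have exactly $c$ common neighbours. If $\Delta$ is a graph with vertex set $V$, let $T(\Delta)$ be the graph whose vertices are two copies $V^+,V^-$ of $V$ and two new vertices $\infty^+,\infty^-$, where $\infty^{+}$ is adjacent to all of $V^{+}$, $\infty^-$ is adjacent to all of $V^-$, $u^+\sim v^+$ and $u^-\sim v^-$ if and only if $u\sim v$ in $\Delta$, and $u^+\sim v^-$ if and only if $u\neq v$ and $u\not\sim v$ in $\Delta$. A Taylor graph is a graph isomorphic to $T(\Delta)$ for some strongly regular graph $\Delta$ with parameters $(n,2c,a,c)$; it has $2n+2$ vertices. A two-graph $\mathcal D$ on a finite set $X$ is a collection of $3$-subsets of $X$ such that every $4$-subset of $X$ contains an even number of them; it is regular if every $2$-subset of $X$ lies in a constant number of members of $\mathcal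 D$. Its descendant at $x\in X$ is the graph on $X\setminus\{x\}$ in which $u\sim v$ if and only if $u\ne v$ and $\{x,u,v\}\in\mathcal D$. A regular two-graph $\mathcal D$ corresponds to a Taylor graph $\Gamma$ if $\Gamma\cong T(\Delta)$ for some descendant $\Delta$ of $\mathcal D$. The descendants of $\Gamma$ are the descendants of the regular two-graphs corresponding to $\Gamma$, or equivalently, up to isomorphism, the subgraphs $\Gamma[x]$ induced on the neighbours of a vertex $x$ of $\Gamma$. Let $\Gamma$ be a Taylor graph with $N=2n+2$ vertices, and let $\log$ be the natural logarithm. Then: (a) $\mu(\Gamma)<2\sqrt n\,\log n+1$; (b) there is an integer $k>0$ such that all descendants of $\Gamma$ (all the graphs $\Gamma[x]$, and all descendants of all regular two-graphs corresponding to $\Gamma$) are regular of valency $k$, and $\mu(\Gamma)<4\,\dfrac{n}{k}\,\log n+1$. In particular $\mu(\Gamma)=O(\sqrt N\log N)$: there is an absolute constant $C$ such that $\mu(\Gamma)\le C\sqrt N\log N$ for every Taylor graph $\Gamma$ on $N$ vertices. -/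

import Mathlib

universe u v

namespace SimpleGraph

/-- `R` is a resolving set: any two distinct vertices are told apart by their distance to some
member of `R`. The extended distance is used, so unreachable means distance `⊤`; on connected
graphs this is the usual graph distance. -/
def IsResolvingSet {V : Type u} (G : SimpleGraph V) (R : Finset V) : Prop :=
  ∀ u w : V, u ≠ w → ∃ r ∈ R, G.edist u r ≠ G.edist w r

/-- The metric dimension of a finite graph: the least size of a resolving set. (The set below is
nonempty for finite `V`, since the set of all vertices is resolving.) -/
noncomputable def metricDim {V : Type u} (G : SimpleGraph V) : ℕ :=
  sInf {m : ℕ | ∃ R : Finset V, R.card = m ∧ G.IsResolvingSet R}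

/-- Every vertex of the (finite) graph `G` has exactly `k` neighbours. -/
def HasValency {V : Type u} (G : SimpleGraph V) (k : ℕ) : Prop :=
  ∀ x : V, (G.neighborSet x).ncard = k

open Classical in
/-- `G` is strongly regular with parameters `(n, k, a, c)` in the sense of distance-regular graphs:
connected of diameter `2` (so neither complete nor empty), with `n` vertices, valency `k`,
`a` common neighbours for adjacent vertices and `c` for distinct non-adjacent ones. -/
def IsStronglyRegular {V : Type u} [Fintype V] (G : SimpleGraph V) (n k a c : ℕ) : Prop :=
  G.Connected ∧ G.diam = 2 ∧ G.IsSRGWith n k a c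

/-- The adjacency relation of the Taylor double: `(some v, true)` is `v⁺`, `(some v, false)` is
`v⁻`, `(none, true)` is `∞⁺` and `(none, false)` is `∞⁻`. -/
def TaylorAdj {V : Type u} (G : SimpleGraph V) : Option V × Bool → Option V × Bool → Prop
  | (none, _), (none, _) => False
  | (none, s), (some _, t) => s = t
  | (some _, s), (none, t) => s = t
  | (some u, s), (some v, t) => (s = t ∧ G.Adj u v) ∨ (s ≠ t ∧ u ≠ v ∧ ¬ G.Adj u v)

/-- The graph built from `G` by taking two signed copies of its vertex set and two new vertices
`∞⁺`, `∞⁻`. -/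
def taylorDouble {V : Type u} (G : SimpleGraph V) : SimpleGraph (Option V × Bool) where
  Adj := G.TaylorAdj
  symm := ⟨by
    rintro ⟨_ | u, s⟩ ⟨_ | v, t⟩ h
    · exact h
    · exact Eq.symm h
    · exact Eq.symm h
    · rcases h with ⟨h1, h2⟩ | ⟨h1, h2, h3⟩
      · exact Or.inl ⟨h1.symm, h2.symm⟩
      · exact Or.inr ⟨h1.symm, h2.symm, fun h => h3 h.symm⟩⟩
  loopless := ⟨by
    rintro ⟨_ | u, s⟩ h
    · exact h
    · rcases h with ⟨_, h2⟩ | ⟨h1, _⟩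
      · exact G.loopless.irrefl u h2
      · exact h1 rfl⟩

/-- A Taylor graph: a graph isomorphic to the double of a strongly regular graph with parameters
`(n, 2c, a, c)`. -/
def IsTaylorGraph {W : Type u} (Γ : SimpleGraph W) : Prop :=
  ∃ (n a c : ℕ) (Δ : SimpleGraph (Fin n)),
    Δ.IsStronglyRegular n (2 * c) a c ∧ Nonempty (Γ ≃g Δ.taylorDouble)

end SimpleGraph

/-- A two-graph on `X`: a collection of `3`-subsets of `X` such that every `4`-subset of `X`
contains an even number of them. -/
structure TwoGraph (X : Type v) where
  triples : Set (Set X)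
  ncard_triple : ∀ t ∈ triples, t.ncard = 3
  even_triples : ∀ s : Set X, s.ncard = 4 → Even {t | t ∈ triples ∧ t ⊆ s}.ncard

namespace TwoGraph

/-- A two-graph is regular if every `2`-subset lies in a constant number of its triples. -/
def IsRegular {X : Type v} (D : TwoGraph X) : Prop :=
  ∃ l : ℕ, ∀ s : Set X, s.ncard = 2 → {t | t ∈ D.triples ∧ s ⊆ t}.ncard = l

/-- The descendant of a two-graph at the point `x`: the graph on the other points whose edges are
the pairs that form a triple of the two-graph together with `x`. -/
def descendant {X : Type v} (D : TwoGraph X) (x : X) : SimpleGraph {y : X // y ≠ x} where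
  Adj p q := ({x, p.1, q.1} : Set X) ∈ D.triples
  symm := ⟨fun p q h => by rwa [Set.pair_comm q.1 p.1]⟩
  loopless := ⟨fun p h => by
    have h3 := D.ncard_triple _ h
    rw [Set.pair_eq_singleton] at h3
    have h2 := Set.ncard_insert_le x {p.1}
    rw [Set.ncard_singleton] at h2
    omega⟩

/-- The two-graph `D` corresponds to the Taylor graph `Γ`: the graph `Γ` is the double of a
descendant of `D`. -/
def CorrespondsTo {X : Type v} (D : TwoGraph X) {W : Type u} (Γ : SimpleGraph W) : Prop :=
  ∃ x : X, Nonempty (Γ ≃g (D.descendant x).taylorDouble)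

end TwoGraph

/-! Write Γ = T(Δ) with Δ of valency 2c on V. The distances from ∞⁺ to ∞⁺, V⁺, V⁻, ∞⁻ are 0, 1, 2,
3, so ∞⁺ leaves only pairs u, w of the same sign to be told apart. For either sign r⁺ does this once
r lies in the symmetric difference of N(u) and N(w) or in {u, w}. Hence ∞⁺ and S⁺ resolve Γ whenever
S ⊆ V meets all these sets (`isResolvingSet_taylorDouble`).

The sets are large: n = 6c - 2a - 1 and 2a + 3 ≤ 3c force at least max(√n, c) points in each. Greedy
covering (`exists_finset_forall_pair`) meets all sets of size at least t with fewer than 2(n/t) log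
n points; t = √n gives (a), and t = c with k = 2c gives (b).

That k serves all descendants because every edge of T(Δ) lies in exactly 2c triangles. -/

/-! ### Greedy covering -/

open Finset in
/-- Greedy covering: if each member of a family contains at least `t` points, then some set of at
most `s` points meets all but a fraction `(1 - t / |V|) ^ s` of the family. -/
theorem exists_finset_card_disjoint_le {ι : Type*} {V : Type*} [Fintype V] [DecidableEq V]
    [Nonempty V] (P : Finset ι) (D : ι → Finset V) (t : ℝ) (ht : t ≤ Fintype.card V)
    (hD : ∀ p ∈ P, t ≤ #(D p)) (s : ℕ) :
    ∃ S : Finset V, #S ≤ s ∧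
      (#{p ∈ P | Disjoint (D p) S} : ℝ) ≤ (1 - t / Fintype.card V) ^ s * #P := by
  have hn : (0 : ℝ) < Fintype.card V := by exact_mod_cast Fintype.card_pos
  induction s with
  | zero => exact ⟨∅, by simp⟩
  | succ s ih =>
    obtain ⟨S, hS, hle⟩ := ih
    set B := {p ∈ P | Disjoint (D p) S} with hB
    have hsum : ∑ v : V, (#{p ∈ B | v ∈ D p} : ℝ) = ∑ p ∈ B, (#(D p) : ℝ) := by
      have h := sum_card_bipartiteAbove_eq_sum_card_bipartiteBelow
        (s := B) (t := (univ : Finset V)) (fun p v => v ∈ D p)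
      simp only [bipartiteAbove, bipartiteBelow, filter_univ_mem] at h
      exact_mod_cast h.symm
    have hlow : t * #B ≤ ∑ p ∈ B, (#(D p) : ℝ) := by
      rw [mul_comm, ← nsmul_eq_mul]
      exact card_nsmul_le_sum _ _ _ fun p hp => hD p (mem_filter.1 hp).1
    -- By double counting, some point lies in at least the average share t / |V| of the sets not yet
    -- met.
    obtain ⟨v, -, hv⟩ : ∃ v ∈ (univ : Finset V),
        t * #B / Fintype.card V ≤ (#{p ∈ B | v ∈ D p} : ℝ) := by
      apply exists_le_of_sum_le univ_nonempty
      rw [hsum, sum_const, card_univ, nsmul_eq_mul, mul_div_cancel₀ _ hn.ne']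
      exact hlow
    refine ⟨insert v S, (card_insert_le _ _).trans (by omega), ?_⟩
    have hsub : {p ∈ P | Disjoint (D p) (insert v S)} = {p ∈ B | ¬ v ∈ D p} := by
      ext p
      simp only [hB, mem_filter, disjoint_insert_right]
      tauto
    have hcard := card_filter_add_card_filter_not (s := B) (fun p => v ∈ D p)
    have hcard' : (#{p ∈ B | v ∈ D p} : ℝ) + #{p ∈ B | ¬ v ∈ D p} = #B := by
      exact_mod_cast hcard
    rw [hsub]
    have h1 : (0 : ℝ) ≤ 1 - t / Fintype.card V := by
      rw [sub_nonneg, div_le_one hn]; exact ht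
    calc (#{p ∈ B | ¬ v ∈ D p} : ℝ) ≤ (1 - t / Fintype.card V) * #B := by
          have : t * #B / Fintype.card V = t / Fintype.card V * #B := by ring
          linarith
      _ ≤ (1 - t / Fintype.card V) * ((1 - t / Fintype.card V) ^ s * #P) := by gcongr
      _ = _ := by ring

open Finset in
/-- If every pair of distinct points is separated by at least `t` of the `n` points, where
`0 < t ≤ n / 2`, then fewer than `2 (n / t) log n` points separate all pairs. -/
theorem exists_finset_forall_pair {V : Type*} [Fintype V] [DecidableEq V]
    (D : V → V → Finset V) (hsymm : ∀ u w, D u w = D w u) (t : ℝ) (ht0 : 0 < t)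
    (ht : 2 * t ≤ Fintype.card V) (hcard : 1 < Fintype.card V)
    (hD : ∀ u w, u ≠ w → t ≤ #(D u w)) :
    ∃ S : Finset V, (#S : ℝ) < 2 * (Fintype.card V / t) * Real.log (Fintype.card V) ∧
      ∀ u w, u ≠ w → ∃ r ∈ S, r ∈ D u w := by
  have hn1 : (1 : ℝ) < Fintype.card V := by exact_mod_cast hcard
  set n : ℝ := (Fintype.card V : ℝ) with hn
  have hn0 : 0 < n := by linarith
  have : Nonempty V := Fintype.card_pos_iff.1 (by omega)
  set L : ℝ := 2 * (n / t) * Real.log n with hL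
  have hlog : 0 < Real.log n := Real.log_pos hn1
  have hLpos : 0 < L := by positivity
  -- The largest integer strictly below L, which makes the final bound strict.
  set s : ℕ := ⌈L⌉₊ - 1 with hs
  have hceil : 0 < ⌈L⌉₊ := Nat.ceil_pos.2 hLpos
  have hs1 : (s : ℝ) = ⌈L⌉₊ - 1 := by rw [hs, Nat.cast_sub hceil]; simp
  have hsL : (s : ℝ) < L := by
    have := Nat.ceil_lt_add_one hLpos.le
    linarith
  have hLs : L - 1 ≤ s := by
    have := Nat.le_ceil L
    linarith
  have hpair : ∀ p ∈ (univ : Finset V).offDiag, t ≤ #(D p.1 p.2) := fun p hp =>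
    hD _ _ (mem_offDiag.1 hp).2.2
  obtain ⟨S, hS, hle⟩ := exists_finset_card_disjoint_le (univ : Finset V).offDiag
    (fun p => D p.1 p.2) t (by linarith) hpair s
  refine ⟨S, lt_of_le_of_lt (by exact_mod_cast hS) hsL, fun u w huw => ?_⟩
  by_contra! hcon
  have hdisj : Disjoint (D u w) S := disjoint_right.2 hcon
  -- Unseparated ordered pairs come in twos, so a count of at most √e < 2 already rules them out.
  have hsub : ({(u, w), (w, u)} : Finset (V × V)) ⊆
      {p ∈ (univ : Finset V).offDiag | Disjoint (D p.1 p.2) S} := by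
    intro p hp
    simp only [mem_insert, mem_singleton] at hp
    rcases hp with rfl | rfl
    · simpa using ⟨huw, hdisj⟩
    · simpa using ⟨huw.symm, hsymm u w ▸ hdisj⟩
  have h2 := card_le_card hsub
  rw [card_pair (by simpa using fun h => (huw h).elim)] at h2
  have h2' : (2 : ℝ) ≤ #{p ∈ (univ : Finset V).offDiag | Disjoint (D p.1 p.2) S} := by
    exact_mod_cast h2
  have hP : (#(univ : Finset V).offDiag : ℝ) ≤ n ^ 2 := by
    rw [offDiag_card, hn, card_univ, sq]
    exact_mod_cast Nat.sub_le _ _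
  have hhalf : Real.exp (1 / 2) < 2 := by
    have h1 : Real.exp (1 / 2) * Real.exp (1 / 2) = Real.exp 1 := by
      rw [← Real.exp_add]; norm_num
    nlinarith [Real.exp_one_lt_d9, Real.exp_pos (1 / 2)]
  have hpow : (1 - t / n) ^ s ≤ Real.exp (1 / 2) / n ^ 2 := by
    have h0 : 0 ≤ 1 - t / n := by
      rw [sub_nonneg, div_le_one hn0]; linarith
    calc (1 - t / n) ^ s ≤ Real.exp (-(t / n)) ^ s := by
          gcongr
          exact Real.one_sub_le_exp_neg _
      _ = Real.exp (s * -(t / n)) := (Real.exp_nat_mul _ _).symm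
      -- Rounding L down costs a factor of at most exp(t/n), and 2t ≤ n bounds it by √e.
      _ ≤ Real.exp (1 / 2 - 2 * Real.log n) := by
          apply Real.exp_le_exp.2
          have h1 : (L - 1) * (t / n) ≤ s * (t / n) := by gcongr
          have h3 : L * (t / n) = 2 * Real.log n := by rw [hL]; field_simp
          have h4 : t / n ≤ 1 / 2 := by rw [div_le_iff₀ hn0]; linarith
          linarith
      _ = Real.exp (1 / 2) / n ^ 2 := by
          rw [Real.exp_sub, show 2 * Real.log n = Real.log n + Real.log n by ring, Real.exp_add,
            Real.exp_log hn0, sq]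
  have hfin : (1 - t / n) ^ s * (#(univ : Finset V).offDiag : ℝ) ≤ Real.exp (1 / 2) := by
    calc _ ≤ Real.exp (1 / 2) / n ^ 2 * n ^ 2 := by gcongr
      _ = _ := by field_simp
  linarith

/-! ### Invariance under isomorphism -/

namespace SimpleGraph

theorem Hom.edist_le {V : Type*} {W : Type*} {G : SimpleGraph V} {H : SimpleGraph W} (f : G →g H)
    (x y : V) : H.edist (f x) (f y) ≤ G.edist x y := by
  by_cases h : G.edist x y = ⊤
  · rw [h]; exact le_top
  · obtain ⟨p, hp⟩ := exists_walk_of_edist_ne_top h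
    rw [← hp, ← Walk.length_map f p]
    exact SimpleGraph.edist_le _

theorem Iso.edist_eq {V : Type*} {W : Type*} {G : SimpleGraph V} {H : SimpleGraph W} (f : G ≃g H)
    (x y : V) : H.edist (f x) (f y) = G.edist x y := by
  refine le_antisymm (f.toHom.edist_le x y) ?_
  simpa using f.symm.toHom.edist_le (f x) (f y)

theorem metricDim_le_of_iso {V : Type*} {W : Type*} {G : SimpleGraph V} {H : SimpleGraph W}
    (f : G ≃g H) {R : Finset W} (hR : H.IsResolvingSet R) : G.metricDim ≤ R.card := by
  refine Nat.sInf_le ⟨R.map f.symm.toEquiv.toEmbedding, Finset.card_map _, fun u w huw => ?_⟩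
  obtain ⟨r, hr, hne⟩ := hR (f u) (f w) (f.injective.ne huw)
  refine ⟨f.symm r, Finset.mem_map_of_mem _ hr, ?_⟩
  rwa [← f.edist_eq, ← f.edist_eq, f.apply_symm_apply]

theorem Iso.ncard_commonNeighbors {V : Type*} {W : Type*} {G : SimpleGraph V} {H : SimpleGraph W}
    (f : G ≃g H) (x y : V) :
    (H.commonNeighbors (f x) (f y)).ncard = (G.commonNeighbors x y).ncard := by
  have h : H.commonNeighbors (f x) (f y) = f '' G.commonNeighbors x y := by
    ext z
    constructor
    · intro hz
      refine ⟨f.symm z, ?_, f.apply_symm_apply z⟩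
      rw [mem_commonNeighbors] at hz ⊢
      rwa [← f.map_adj_iff, ← f.map_adj_iff, f.apply_symm_apply]
    · rintro ⟨z, hz, rfl⟩
      rw [mem_commonNeighbors] at hz ⊢
      rwa [f.map_adj_iff, f.map_adj_iff]
  rw [h, Set.ncard_image_of_injective _ f.injective]

theorem ncard_neighborSet_induce {V : Type*} (G : SimpleGraph V) (x : V)
    (y : G.neighborSet x) :
    ((G.induce (G.neighborSet x)).neighborSet y).ncard = (G.commonNeighbors x y).ncard := by
  have h : G.commonNeighbors x y =
      Subtype.val '' (G.induce (G.neighborSet x)).neighborSet y := by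
    ext z
    simp [mem_commonNeighbors, and_comm]
  rw [h, Set.ncard_image_of_injective _ Subtype.val_injective]

theorem commonNeighbors_taylorDouble_none {V : Type*} (G : SimpleGraph V) (v : V) :
    G.taylorDouble.commonNeighbors (none, true) (some v, true) =
      (fun w => (some w, true)) '' G.neighborSet v := by
  ext ⟨_ | w, t⟩
  · simp [mem_commonNeighbors, taylorDouble, TaylorAdj]
  · cases t <;> simp [mem_commonNeighbors, taylorDouble, TaylorAdj]

/-! ### Parameters of the base graph -/

/-- The arithmetic and counting data of a strongly regular graph with parameters `(n, 2c, a, c)`. -/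
structure IsTaylorBase {V : Type*} (G : SimpleGraph V) (n a c : ℕ) : Prop where
  card_eq : Nat.card V = n
  valency : G.HasValency (2 * c)
  of_adj : ∀ v w, G.Adj v w → (G.commonNeighbors v w).ncard = a
  of_not_adj : ∀ v w, v ≠ w → ¬ G.Adj v w → (G.commonNeighbors v w).ncard = c
  param : n + 2 * a + 1 = 6 * c
  bound : 4 * a + 6 ≤ 6 * c

theorem IsStronglyRegular.isTaylorBase {V : Type*} [Fintype V] {G : SimpleGraph V} {n a c : ℕ}
    (h : G.IsStronglyRegular n (2 * c) a c) : G.IsTaylorBase n a c := by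
  classical
  obtain ⟨hconn, hdiam, hsrg⟩ := h
  have hval : G.HasValency (2 * c) := fun x => by
    rw [← hsrg.regular x, ← card_neighborSet_eq_degree, Set.ncard_eq_toFinset_card',
      Set.toFinset_card]
  have hadj : ∀ v w, G.Adj v w → (G.commonNeighbors v w).ncard = a := fun v w hvw => by
    rw [← hsrg.of_adj v w hvw, Set.ncard_eq_toFinset_card', Set.toFinset_card]
  have hnadj : ∀ v w, v ≠ w → ¬ G.Adj v w → (G.commonNeighbors v w).ncard = c :=
    fun v w hne hvw => by
      rw [← hsrg.of_not_adj hne hvw, Set.ncard_eq_toFinset_card', Set.toFinset_card]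
  have := hconn.nonempty
  obtain ⟨u, w, huw⟩ := G.exists_dist_eq_diam
  rw [hdiam] at huw
  have he : G.edist u w = 2 := by
    rw [← (hconn u w).coe_dist_eq_edist, huw]; rfl
  obtain ⟨hne, hna, v, hv⟩ := edist_eq_two_iff.1 he
  rw [mem_commonNeighbors] at hv
  -- Inclusion-exclusion inside N(v), for v a common neighbour of non-adjacent u, w: 2a ≤ (2c - 2) +
  -- (c - 1). The terms removed are u, w from N(v), and v from the common neighbours of u, w.
  have hunion := Set.ncard_union_add_ncard_inter (G.commonNeighbors u v) (G.commonNeighbors w v)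
  have h1 : (G.commonNeighbors u v ∪ G.commonNeighbors w v).ncard + 2 ≤ 2 * c := by
    rw [← hval v, ← Set.ncard_pair hne, ← Set.ncard_union_eq]
    · apply Set.ncard_le_ncard _ (Set.toFinite _)
      rintro x ((hx | hx) | rfl | rfl)
      · exact hx.2
      · exact hx.2
      · exact hv.1.symm
      · exact hv.2.symm
    · rw [Set.disjoint_left]
      rintro x (hx | hx) (rfl | rfl)
      · exact G.loopless.irrefl _ hx.1
      · exact hna hx.1
      · exact hna hx.1.symm
      · exact G.loopless.irrefl _ hx.1
  have h2 : (G.commonNeighbors u v ∩ G.commonNeighbors w v).ncard + 1 ≤ c := by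
    rw [← hnadj u w hne hna, ← Set.ncard_singleton v, ← Set.ncard_union_eq]
    · apply Set.ncard_le_ncard _ (Set.toFinite _)
      rintro x (hx | rfl)
      · exact ⟨hx.1.1, hx.2.1⟩
      · exact hv
    · rw [Set.disjoint_left]
      rintro x hx rfl
      exact G.loopless.irrefl _ hx.1.2
  rw [hadj _ _ hv.1, hadj _ _ hv.2] at hunion
  have hn : 0 < n := by rw [← hsrg.card]; exact Fintype.card_pos
  have hlt : 2 * c < n := by
    rw [← hsrg.card, ← hsrg.regular u]; exact G.degree_lt_card_verts u
  have hparam := hsrg.param_eq G hn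
  refine ⟨by rw [Nat.card_eq_fintype_card, hsrg.card], hval, hadj, hnadj, ?_, by omega⟩
  -- This is k(k - a - 1) = (n - k - 1)c at k = 2c; cancelling c makes it linear.
  have h3 : c * (2 * (2 * c - a - 1)) = c * (n - 2 * c - 1) := by linarith
  have h4 := Nat.eq_of_mul_eq_mul_left (by omega : 0 < c) h3
  omega

theorem ncard_option_prod_bool {V : Type*} [Finite V] (A B : Set V) (s : Bool) :
    ((fun w => ((some w, s) : Option V × Bool)) '' A ∪
      (fun w => (some w, !s)) '' B).ncard = A.ncard + B.ncard := by
  rw [Set.ncard_union_eq, Set.ncard_image_of_injective, Set.ncard_image_of_injective]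
  · intro x y h; simpa using h
  · intro x y h; simpa using h
  · rw [Set.disjoint_left]
    rintro _ ⟨x, -, rfl⟩ ⟨y, -, h⟩
    simp at h

namespace IsTaylorBase

variable {V : Type*} [Finite V] {G : SimpleGraph V} {n a c : ℕ}

theorem ncard_sdiff_of_adj (h : G.IsTaylorBase n a c) {u w : V} (huw : G.Adj u w) :
    (G.neighborSet u \ G.neighborSet w).ncard + a = 2 * c := by
  rw [← h.of_adj u w huw, ← h.valency u, commonNeighbors_eq, add_comm]
  exact Set.ncard_inter_add_ncard_sdiff_eq_ncard _ _ (Set.toFinite _)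

theorem ncard_sdiff_of_not_adj (h : G.IsTaylorBase n a c) {u w : V} (hne : u ≠ w)
    (huw : ¬ G.Adj u w) : (G.neighborSet u \ G.neighborSet w).ncard = c := by
  have h1 := Set.ncard_inter_add_ncard_sdiff_eq_ncard (G.neighborSet u) (G.neighborSet w)
    (Set.toFinite _)
  rw [← commonNeighbors_eq, h.of_not_adj u w hne huw, h.valency u] at h1
  omega

theorem ncard_compl_union_of_adj (h : G.IsTaylorBase n a c) {u w : V} (huw : G.Adj u w) :
    (G.neighborSet u ∪ G.neighborSet w)ᶜ.ncard + a + 1 = 2 * c := by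
  have h1 := Set.ncard_union_add_ncard_inter (G.neighborSet u) (G.neighborSet w)
  have h2 := Set.ncard_add_ncard_compl (G.neighborSet u ∪ G.neighborSet w)
  rw [← commonNeighbors_eq, h.of_adj u w huw, h.valency u, h.valency w] at h1
  rw [h.card_eq] at h2
  have := h.param
  omega

/-- An edge at ∞^± sees one neighbourhood of Δ, of size 2c; an edge within a sign sees 1 + a + (2c -
a - 1); an edge across signs sees c + c. -/
theorem ncard_commonNeighbors_taylorDouble (h : G.IsTaylorBase n a c) (x y : Option V × Bool)
    (hxy : G.taylorDouble.Adj x y) : (G.taylorDouble.commonNeighbors x y).ncard = 2 * c := by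
  have hinf : ∀ (v : V) (s : Bool),
      (G.taylorDouble.commonNeighbors (none, s) (some v, s)).ncard = 2 * c := by
    intro v s
    have : G.taylorDouble.commonNeighbors (none, s) (some v, s) =
        (fun w => (some w, s)) '' G.neighborSet v := by
      ext ⟨_ | w, t⟩
      · simp [mem_commonNeighbors, taylorDouble, TaylorAdj]
      · cases s <;> cases t <;> simp [mem_commonNeighbors, taylorDouble, TaylorAdj]
    rw [this, Set.ncard_image_of_injective _ (fun x y h => by simpa using h), h.valency v]
  obtain ⟨_ | u, s⟩ := x <;> obtain ⟨_ | w, t⟩ := y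
  · exact hxy.elim
  · obtain rfl : s = t := hxy
    exact hinf w s
  · obtain rfl : s = t := hxy
    rw [commonNeighbors_symm]
    exact hinf u s
  · rcases hxy with ⟨rfl, huw⟩ | ⟨hst, hne, huw⟩
    · have : G.taylorDouble.commonNeighbors (some u, s) (some w, s) =
          insert (none, s) ((fun w => ((some w, s) : Option V × Bool)) '' G.commonNeighbors u w ∪
            (fun w => (some w, !s)) '' (G.neighborSet u ∪ G.neighborSet w)ᶜ) := by
        ext ⟨_ | x, t⟩
        · cases s <;> cases t <;> simp [mem_commonNeighbors, taylorDouble, TaylorAdj]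
        · have h1 : u = x → G.Adj w x := by rintro rfl; exact huw.symm
          have h2 : w = x → G.Adj u x := by rintro rfl; exact huw
          cases s <;> cases t <;> simp [mem_commonNeighbors, taylorDouble, TaylorAdj] <;> tauto
      rw [this, Set.ncard_insert_of_notMem (by simp) (Set.toFinite _), ncard_option_prod_bool,
        h.of_adj u w huw]
      have := h.ncard_compl_union_of_adj huw
      omega
    · obtain rfl : t = !s := by cases s <;> cases t <;> simp_all
      have : G.taylorDouble.commonNeighbors (some u, s) (some w, !s) =
          (fun w => ((some w, s) : Option V × Bool)) '' (G.neighborSet u \ G.neighborSet w) ∪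
            (fun w => (some w, !s)) '' (G.neighborSet w \ G.neighborSet u) := by
        ext ⟨_ | x, t⟩
        · cases s <;> cases t <;> simp [mem_commonNeighbors, taylorDouble, TaylorAdj]
        · have h1 : u = x → ¬ G.Adj w x := by rintro rfl; exact fun h => huw h.symm
          have h2 : w = x → ¬ G.Adj u x := by rintro rfl; exact huw
          cases s <;> cases t <;> simp [mem_commonNeighbors, taylorDouble, TaylorAdj] <;> tauto
      rw [this, ncard_option_prod_bool, h.ncard_sdiff_of_not_adj hne huw,
        h.ncard_sdiff_of_not_adj hne.symm (fun h => huw h.symm)]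
      omega

end IsTaylorBase

/-! ### Distances and resolving sets in the double -/

/-- Antipodes have no common neighbour. Excluding distance 2 suffices, since the competing distance
is always exactly 2. -/
theorem edist_taylorDouble_none_ne_two {V : Type*} {G : SimpleGraph V} :
    G.taylorDouble.edist (none, false) (none, true) ≠ 2 := by
  rw [Ne, edist_eq_two_iff]
  rintro ⟨-, -, ⟨_ | w, t⟩, hz⟩
  · exact hz.1
  · have h1 : false = t := hz.1
    have h2 : true = t := hz.2
    simp [← h1] at h2

theorem edist_taylorDouble_antipode_ne_two {V : Type*} {G : SimpleGraph V} (u : V) :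
    G.taylorDouble.edist (some u, false) (some u, true) ≠ 2 := by
  rw [Ne, edist_eq_two_iff]
  rintro ⟨-, -, ⟨_ | w, t⟩, hz⟩
  · have h1 : false = t := hz.1
    have h2 : true = t := hz.2
    simp [← h1] at h2
  · cases t <;> simp [mem_commonNeighbors, taylorDouble, TaylorAdj] at hz <;> tauto

theorem IsTaylorBase.edist_taylorDouble_some_none {V : Type*} {G : SimpleGraph V} {n a c : ℕ}
    (h : G.IsTaylorBase n a c) (v : V) :
    G.taylorDouble.edist (some v, false) (none, true) = 2 := by
  have hbound := h.bound
  have hparam := h.param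
  obtain ⟨w, hw⟩ : ∃ w, w ∉ insert v (G.neighborSet v) := by
    by_contra! hall
    have h1 := Set.ncard_insert_le v (G.neighborSet v)
    rw [Set.eq_univ_of_forall hall, Set.ncard_univ, h.card_eq, h.valency v] at h1
    omega
  simp only [Set.mem_insert_iff, mem_neighborSet, not_or] at hw
  rw [edist_eq_two_iff]
  refine ⟨by simp, by simp [taylorDouble, TaylorAdj], (some w, true), ?_⟩
  simp [mem_commonNeighbors, taylorDouble, TaylorAdj, Ne.symm hw.1, hw.2]

/-- The vertices at different distances from `u` and `w`, in a graph of diameter `2`. -/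
def separators {V : Type*} (G : SimpleGraph V) (u w : V) : Set V :=
  (G.neighborSet u \ G.neighborSet w) ∪ (G.neighborSet w \ G.neighborSet u) ∪ {u, w}

theorem separators_comm {V : Type*} (G : SimpleGraph V) (u w : V) :
    G.separators u w = G.separators w u := by
  rw [separators, separators, Set.pair_comm u w, Set.union_comm (_ \ _) (_ \ _)]

namespace IsTaylorBase

variable {V : Type*} [Finite V] {G : SimpleGraph V} {n a c : ℕ}

theorem min_le_ncard_separators (h : G.IsTaylorBase n a c) {u w : V} (hne : u ≠ w) :
    min (2 * c + 2) (4 * c - 2 * a) ≤ (G.separators u w).ncard := by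
  have hdisj : Disjoint (G.neighborSet u \ G.neighborSet w) (G.neighborSet w \ G.neighborSet u) :=
    disjoint_sdiff_sdiff
  by_cases huw : G.Adj u w
  · refine (min_le_right _ _).trans ?_
    have h1 := h.ncard_sdiff_of_adj huw
    have h2 := h.ncard_sdiff_of_adj huw.symm
    have hsub : (G.neighborSet u \ G.neighborSet w) ∪ (G.neighborSet w \ G.neighborSet u) ⊆
        G.separators u w := Set.subset_union_left
    have h3 := Set.ncard_le_ncard hsub (Set.toFinite _)
    rw [Set.ncard_union_eq hdisj] at h3
    omega
  · refine (min_le_left _ _).trans ?_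
    have hwu : ¬ G.Adj w u := fun h => huw h.symm
    rw [separators, Set.ncard_union_eq ?_, Set.ncard_union_eq hdisj, Set.ncard_pair hne,
      h.ncard_sdiff_of_not_adj hne huw, h.ncard_sdiff_of_not_adj hne.symm hwu]
    · omega
    · rw [Set.disjoint_left]
      rintro x hx (rfl | rfl)
      · simp [hwu] at hx
      · simp [huw] at hx

theorem edist_taylorDouble_of_adj (h : G.IsTaylorBase n a c) {u w : V} (huw : G.Adj u w) :
    G.taylorDouble.edist (some w, false) (some u, true) = 2 := by
  have hbound := h.bound
  have h1 := h.ncard_sdiff_of_adj huw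
  -- The path is w⁻, z⁺, u⁺. The vertex w itself lies in N(u) \ N(w), so a second element is needed.
  obtain ⟨z, ⟨h2, h3⟩, hzw⟩ := Set.exists_ne_of_one_lt_ncard
    (s := G.neighborSet u \ G.neighborSet w) (by omega) w
  rw [edist_eq_two_iff]
  refine ⟨by simp, by simp [taylorDouble, TaylorAdj, huw.symm], (some z, true), ?_⟩
  rw [mem_neighborSet] at h2 h3
  simp [mem_commonNeighbors, taylorDouble, TaylorAdj, hzw.symm, h2, h3]

theorem isResolvingSet_taylorDouble (h : G.IsTaylorBase n a c) {S : Finset V}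
    (hS : ∀ u w, u ≠ w → ∃ r ∈ S, r ∈ G.separators u w) {R : Finset (Option V × Bool)}
    (hR0 : (none, true) ∈ R) (hR : ∀ r ∈ S, (some r, true) ∈ R) :
    G.taylorDouble.IsResolvingSet R := by
  intro x y hxy
  by_contra! hcon
  have heq : ∀ r ∈ R, (x = r ↔ y = r) := fun r hr => by
    rw [← edist_eq_zero_iff (G := G.taylorDouble), hcon r hr, edist_eq_zero_iff]
  have hadj : ∀ r ∈ R, (G.taylorDouble.Adj x r ↔ G.taylorDouble.Adj y r) := fun r hr => by
    rw [← edist_eq_one_iff_adj, hcon r hr, edist_eq_one_iff_adj]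
  have e0 := heq _ hR0
  have a0 := hadj _ hR0
  have d0 := hcon _ hR0
  obtain ⟨_ | u, s⟩ := x <;> obtain ⟨_ | w, t⟩ := y
  · clear hcon heq hadj
    cases s <;> cases t <;> simp_all
  · cases s <;> cases t
    · exact edist_taylorDouble_none_ne_two (d0.trans (h.edist_taylorDouble_some_none w))
    · exact absurd (a0.2 rfl) not_false
    · exact absurd (e0.1 rfl) (by simp)
    · exact absurd (e0.1 rfl) (by simp)
  · cases s <;> cases t
    · exact edist_taylorDouble_none_ne_two (d0.symm.trans (h.edist_taylorDouble_some_none u))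
    · exact absurd (e0.2 rfl) (by simp)
    · exact absurd (a0.1 rfl) not_false
    · exact absurd (e0.2 rfl) (by simp)
  · obtain rfl : s = t := by
      change s = true ↔ t = true at a0
      exact Bool.eq_iff_iff.2 a0
    have huw : u ≠ w := by rintro rfl; exact hxy rfl
    obtain ⟨r, hr, hsep⟩ := hS u w huw
    have er := heq _ (hR r hr)
    have ar := hadj _ (hR r hr)
    have dr := hcon _ (hR r hr)
    simp only [separators, Set.mem_union, Set.mem_sdiff, mem_neighborSet,
      Set.mem_insert_iff, Set.mem_singleton_iff] at hsep
    clear hcon heq hadj e0 a0 d0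
    cases s
    -- At r = u, r⁺ is the antipode of u⁻, whereas w⁻ is at distance 1 or 2 from it; r = w is
    -- symmetric. For any other r adjacency to r⁺ is complemented, which still separates.
    · by_cases hru : r = u
      · subst hru
        by_cases hrw : G.Adj r w
        · exact edist_taylorDouble_antipode_ne_two r
            (dr.trans (h.edist_taylorDouble_of_adj hrw))
        · have : ¬ G.Adj w r := fun h => hrw h.symm
          simp [taylorDouble, TaylorAdj, huw.symm, this] at ar
      · by_cases hrw : r = w
        · subst hrw
          by_cases hur : G.Adj r u
          · exact edist_taylorDouble_antipode_ne_two r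
              (dr.symm.trans (h.edist_taylorDouble_of_adj hur))
          · have : ¬ G.Adj u r := fun h => hur h.symm
            simp [taylorDouble, TaylorAdj, huw, this] at ar
        · simp [taylorDouble, TaylorAdj, Ne.symm hru, Ne.symm hrw] at ar
          tauto
    · simp only [taylorDouble, TaylorAdj, ne_eq, not_true_eq_false, true_and, false_and,
        or_false] at ar
      simp only [Prod.mk.injEq, Option.some.injEq, and_true] at er
      rcases hsep with (hs | hs) | rfl | rfl
      · tauto
      · tauto
      · exact huw (er.1 rfl).symm
      · exact huw (er.2 rfl)

/-! ### Bounds on the metric dimension -/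

theorem metricDim_lt {W : Type*} (h : G.IsTaylorBase n a c) {Γ : SimpleGraph W}
    (f : Γ ≃g G.taylorDouble) (t : ℝ) (ht0 : 0 < t) (ht : 2 * t ≤ n)
    (hle : t ≤ (min (2 * c + 2) (4 * c - 2 * a) : ℕ)) :
    (Γ.metricDim : ℝ) < 2 * (n / t) * Real.log n + 1 := by
  classical
  have := Fintype.ofFinite V
  have hbound := h.bound
  have hparam := h.param
  have hcard : Fintype.card V = n := by rw [← h.card_eq, Nat.card_eq_fintype_card]
  obtain ⟨S, hS, hsep⟩ := exists_finset_forall_pair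
    (fun u w => (G.separators u w).toFinset)
    (fun u w => by simp only [G.separators_comm u w]) t ht0 (by rwa [hcard]) (by omega)
    (fun u w hne => hle.trans (by
      rw [← Set.ncard_eq_toFinset_card']
      exact_mod_cast h.min_le_ncard_separators hne))
  simp only [Set.mem_toFinset] at hsep
  rw [hcard] at hS
  have hres := h.isResolvingSet_taylorDouble hsep
    (R := insert (none, true) (S.image fun r => (some r, true)))
    (Finset.mem_insert_self _ _)
    (fun r hr => Finset.mem_insert_of_mem (Finset.mem_image_of_mem _ hr))
  have h1 : Γ.metricDim ≤ S.card + 1 := (metricDim_le_of_iso f hres).trans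
    ((Finset.card_insert_le _ _).trans (by gcongr; exact Finset.card_image_le))
  have h2 : (Γ.metricDim : ℝ) ≤ S.card + 1 := by exact_mod_cast h1
  linarith

theorem metricDim_lt_sqrt {W : Type*} (h : G.IsTaylorBase n a c) {Γ : SimpleGraph W}
    (f : Γ ≃g G.taylorDouble) : (Γ.metricDim : ℝ) < 2 * Real.sqrt n * Real.log n + 1 := by
  have hbound := h.bound
  have hparam := h.param
  have hn : (4 : ℝ) ≤ n := by exact_mod_cast (by omega : 4 ≤ n)
  have hsq : Real.sqrt n * Real.sqrt n = n := Real.mul_self_sqrt (by linarith)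
  have hpos : 0 < Real.sqrt n := Real.sqrt_pos.2 (by linarith)
  have h2 : 2 ≤ Real.sqrt n := Real.le_sqrt_of_sq_le (by linarith)
  -- For adjacent pairs put d = 2c - a: then n ≤ 6d - 3 ≤ (2d)².
  have hmin : n ≤ (min (2 * c + 2) (4 * c - 2 * a)) ^ 2 := by
    rcases min_cases (2 * c + 2) (4 * c - 2 * a) with ⟨he, -⟩ | ⟨he, -⟩ <;> rw [he]
    · nlinarith
    · obtain ⟨d, hd⟩ : ∃ d, 2 * c = a + d := ⟨2 * c - a, by omega⟩
      have : 4 * c - 2 * a = 2 * d := by omega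
      rw [this]
      have h3 : n + 3 ≤ 6 * d := by omega
      zify at h3 ⊢
      nlinarith [sq_nonneg (2 * (d : ℤ) - 2)]
  have hle : Real.sqrt n ≤ (min (2 * c + 2) (4 * c - 2 * a) : ℕ) :=
    Real.sqrt_le_iff.2 ⟨by positivity, by exact_mod_cast hmin⟩
  have := h.metricDim_lt f (Real.sqrt n) hpos (by nlinarith) hle
  rwa [Real.div_sqrt] at this

theorem metricDim_lt_div {W : Type*} (h : G.IsTaylorBase n a c) {Γ : SimpleGraph W}
    (f : Γ ≃g G.taylorDouble) :
    (Γ.metricDim : ℝ) < 4 * ((n : ℝ) / (2 * c : ℕ)) * Real.log n + 1 := by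
  have hbound := h.bound
  have hparam := h.param
  have hc : (0 : ℝ) < c := by exact_mod_cast (by omega : 0 < c)
  have := h.metricDim_lt f c hc (by exact_mod_cast (by omega : 2 * c ≤ n))
    (by exact_mod_cast le_min (by omega) (by omega))
  convert this using 2
  push_cast
  field_simp
  ring

end IsTaylorBase

/-! ### Valency of the descendants -/

theorem hasValency_of_ncard_commonNeighbors {V W : Type*} {G : SimpleGraph V}
    {Γ : SimpleGraph W} {k : ℕ}
    (hΓ : ∀ x y, Γ.Adj x y → (Γ.commonNeighbors x y).ncard = k) (f : Γ ≃g G.taylorDouble) :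
    G.HasValency k := by
  intro v
  have hinj : Function.Injective (fun w : V => ((some w, true) : Option V × Bool)) :=
    fun x y h => by simpa using h
  have hadj : G.taylorDouble.Adj (none, true) (some v, true) := rfl
  rw [← hΓ _ _ (f.symm.map_adj_iff.2 hadj), f.symm.ncard_commonNeighbors,
    commonNeighbors_taylorDouble_none, Set.ncard_image_of_injective _ hinj]

end SimpleGraph

/-- Sending q to {x, p, q} matches the neighbours of p in the descendant at x with the triples
through {x, p}, whose number is independent of x and p. -/
theorem TwoGraph.IsRegular.exists_hasValency_descendant {X : Type*} [Finite X] {D : TwoGraph X}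
    (hD : D.IsRegular) : ∃ l : ℕ, ∀ x : X, (D.descendant x).HasValency l := by
  obtain ⟨l, hl⟩ := hD
  refine ⟨l, fun x p => ?_⟩
  rw [← hl {x, p.1} (Set.ncard_pair p.2.symm)]
  have hinj : Set.InjOn (fun q : {y : X // y ≠ x} => ({x, p.1, q.1} : Set X))
      ((D.descendant x).neighborSet p) := by
    intro q hq r hr hqr
    have h3 : q ≠ p := fun h => (D.descendant x).loopless.irrefl p (h ▸ hq)
    have hmem : q.1 ∈ ({x, p.1, r.1} : Set X) := by
      have : q.1 ∈ ({x, p.1, q.1} : Set X) := by simp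
      simpa only [hqr] using this
    rcases hmem with h | h | h
    · exact (q.2 h).elim
    · exact (h3 (Subtype.ext h)).elim
    · exact Subtype.ext h
  rw [← hinj.ncard_image]
  congr 1
  ext t
  constructor
  · rintro ⟨q, hq, rfl⟩
    exact ⟨hq, by rintro y (rfl | rfl) <;> simp⟩
  · rintro ⟨ht, hsub⟩
    have h3 := D.ncard_triple t ht
    have hdiff : (t \ {x, p.1}).ncard = 1 := by
      rw [Set.ncard_sdiff hsub, h3, Set.ncard_pair p.2.symm]
    obtain ⟨q, hq⟩ := Set.ncard_eq_one.1 hdiff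
    have hqm : q ∈ t \ {x, p.1} := by rw [hq]; rfl
    have hqx : q ≠ x := fun h => hqm.2 (by simp [h])
    have hteq : ({x, p.1, q} : Set X) = t := by
      rw [← Set.union_sdiff_cancel hsub, hq]
      ext y
      simp only [Set.mem_union, Set.mem_insert_iff, Set.mem_singleton_iff, or_assoc]
    refine ⟨⟨q, hqx⟩, ?_, hteq⟩
    change ({x, p.1, q} : Set X) ∈ D.triples
    rwa [hteq]

namespace SimpleGraph

theorem ncard_commonNeighbors_of_iso_taylorDouble {V W : Type*} [Finite V] {G : SimpleGraph V}
    {n a c : ℕ} (h : G.IsTaylorBase n a c) {Γ : SimpleGraph W} (f : Γ ≃g G.taylorDouble)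
    (x y : W) (hxy : Γ.Adj x y) : (Γ.commonNeighbors x y).ncard = 2 * c := by
  rw [← f.ncard_commonNeighbors]
  exact h.ncard_commonNeighbors_taylorDouble _ _ (f.map_adj_iff.2 hxy)

theorem card_eq_of_iso_taylorDouble {W : Type*} [Fintype W] {Γ : SimpleGraph W} {n : ℕ}
    {G : SimpleGraph (Fin n)} (f : Γ ≃g G.taylorDouble) : Fintype.card W = 2 * n + 2 := by
  rw [Fintype.card_congr f.toEquiv]
  simp
  ring

end SimpleGraph

theorem mainTheorem8 :
    (∀ (W : Type u) [Fintype W] (Γ : SimpleGraph W) (n : ℕ),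
      Γ.IsTaylorGraph → Fintype.card W = 2 * n + 2 →
        (Γ.metricDim : ℝ) < 2 * Real.sqrt n * Real.log n + 1 ∧
        ∃ k : ℕ, 0 < k ∧
          (∀ x : W, (Γ.induce (Γ.neighborSet x)).HasValency k) ∧
          (∀ (X : Type v) [Finite X] (D : TwoGraph X),
            D.IsRegular → D.CorrespondsTo Γ → ∀ y : X, (D.descendant y).HasValency k) ∧
          (Γ.metricDim : ℝ) < 4 * ((n : ℝ) / k) * Real.log n + 1) ∧
    (∃ C : ℝ, ∀ (W : Type u) [Fintype W] (Γ : SimpleGraph W), Γ.IsTaylorGraph →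
      (Γ.metricDim : ℝ) ≤
        C * (Real.sqrt (Fintype.card W) * Real.log (Fintype.card W))) := by
  -- The constant is 2 + 1: the additive 1 is absorbed because √N log N ≥ 1.
  refine ⟨?_, 3, ?_⟩
  · rintro W _ Γ n ⟨n', a, c, Δ, hΔ, ⟨f⟩⟩ hcard
    obtain rfl : n' = n := by
      have := SimpleGraph.card_eq_of_iso_taylorDouble f
      omega
    have h := hΔ.isTaylorBase
    have hbound := h.bound
    have hparam := h.param
    have hcn := SimpleGraph.ncard_commonNeighbors_of_iso_taylorDouble h f
    refine ⟨h.metricDim_lt_sqrt f, 2 * c, by omega, fun x y => ?_, ?_, h.metricDim_lt_div f⟩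
    · rw [SimpleGraph.ncard_neighborSet_induce]
      exact hcn _ _ y.2
    · rintro X _ D hD ⟨x, ⟨g⟩⟩ y
      obtain ⟨l, hl⟩ := hD.exists_hasValency_descendant
      have hx := SimpleGraph.hasValency_of_ncard_commonNeighbors hcn g
      -- A vertex is needed to identify l with 2c; an empty descendant would leave Γ with only two
      -- vertices.
      have hne : Nonempty {z : X // z ≠ x} := by
        by_contra hempty
        rw [not_nonempty_iff] at hempty
        have h1 := Fintype.card_congr g.toEquiv
        simp at h1
        omega
      obtain ⟨z⟩ := hne
      have : l = 2 * c := (hl x z).symm.trans (hx z)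
      exact this ▸ hl y
  · rintro W _ Γ ⟨n, a, c, Δ, hΔ, ⟨f⟩⟩
    have h := hΔ.isTaylorBase
    have hbound := h.bound
    have hparam := h.param
    have hlt := h.metricDim_lt_sqrt f
    have hn : (4 : ℝ) ≤ n := by exact_mod_cast (by omega : 4 ≤ n)
    have hN : (Fintype.card W : ℝ) = 2 * n + 2 := by
      exact_mod_cast SimpleGraph.card_eq_of_iso_taylorDouble f
    have hlog1 : 1 ≤ Real.log (Fintype.card W) := by
      rw [Real.le_log_iff_exp_le (by linarith), hN]
      linarith [Real.exp_one_lt_d9]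
    have hsqrt1 : 1 ≤ Real.sqrt (Fintype.card W) := Real.one_le_sqrt.2 (by linarith)
    have hlog : Real.log n ≤ Real.log (Fintype.card W) :=
      Real.log_le_log (by linarith) (by linarith)
    have hsqrt : Real.sqrt n ≤ Real.sqrt (Fintype.card W) := Real.sqrt_le_sqrt (by linarith)
    have hmul : Real.sqrt n * Real.log n ≤
        Real.sqrt (Fintype.card W) * Real.log (Fintype.card W) := by
      have : 0 ≤ Real.log n := Real.log_nonneg (by linarith)
      gcongr
    nlinarith
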